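/- All graphs are finite and simple. For a vertex $v$ of a graph $G$ let $N(v)$ be the set of neighbours of $v$, and for $S\subseteq V(G)$ let $N(S)=\bigcup_{v\in S}N(v)$. A set $S\subseteq V(G)$ is a total dominating set (TD-set) if every vertex of $G$ has a neighbour in $S$; $\Gamma_t(G)$ is the maximum cardinality of an inclusion-minimal TD-set. A set $S$ is open-open irredundant if $N(v)\setminus N(S\setminus\{v\})\neq\emptyset$ for every $v\in S$; $\mathrm{OOIR}(G)$ is the maximum cardinality of such a set. The indicated total domination game on a graph $G$ without isolated vertices is played as follows, starting with $D=\emptyset$: in each round Dominator indicates a vertex $v$ that has no neighbour in $D$, and Staller chooses a neighbour of $v$ not yet in $D$ and adds it to $D$. The game ends when $D$ is a TD-set. Dominator wants to minimize the final size $|D|$ and Staller wants to maximize it; $\gamma_t^i(G)$ is the final size of $D$ under optimal play. Let $H=P_4\oplus P_4$ be the join of two disjoint paths $u_1v_1w_1x_1$ and $u_2v_2w_2x_2$ of order $4$ (all edges between the two paths are added). For $k\ge 1$ let $H_1,\dots,H_k$ be disjoint copies of $H$, where $u_{i,j},v_{i,j},w_{i,j},x_{i,j}$ denote the vertices of $H_i$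 corresponding to $u_j,v_j,w_j,x_j$. Let $G_1=H_1$, and for $k\ge 2$ let $G_k$ be obtained from the disjoint union of $H_1,\dots,H_k$ by adding the edges $w_{i,2}w_{i+1,1}$ for all $i\in\{1,\dots,k\}$, with $i+1$ taken modulo $k$. **Proposition.** For every $k\ge 1$, $$\gamma_t^i(G_k)=3k,\qquad \Gamma_t(G_k)=2k,\qquad \mathrm{OOIR}(G_k)=2k.$$ Consequently, for every $m\ge 0$ there is a $k\ge 1$ such that $G_k$ is connected, $\gamma_t^i(G_k)\ge \Gamma_t(G_k)+m$ and $\gamma_t^i(G_k)\ge \mathrm{OOIR}(G_k)+m$. -/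

import Mathlib

namespace IndicatedTotalDomination

/-- The join of two graphs: their disjoint union together with all edges between the two parts. -/
def graphJoin {V W : Type*} (G : SimpleGraph V) (H : SimpleGraph W) : SimpleGraph (V ⊕ W) :=
  (G ⊕g H) ⊔ completeBipartiteGraph V W

section Invariants

variable {V : Type*}

/-- `v` is totally dominated by the set `D`: it has a neighbor in `D`. -/
def TotallyDominated (G : SimpleGraph V) (D : Finset V) (v : V) : Prop :=
  ∃ u ∈ D, G.Adj u v

/-- `D` is a total dominating set (TD-set): every vertex has a neighbor in `D`. -/
def IsTotalDominatingSet (G : SimpleGraph V) (D : Finset V) : Prop :=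
  ∀ v, TotallyDominated G D v

/-- The upper total domination number: the maximum cardinality of an (inclusion-)minimal
TD-set. -/
noncomputable def upperTotalDominationNumber (G : SimpleGraph V) : ℕ :=
  sSup {n | ∃ S : Finset V, Minimal (IsTotalDominatingSet G) S ∧ S.card = n}

/-- `S` is open-open irredundant: for every `v ∈ S`, the set `N(v) \ N(S \ {v})` is nonempty. -/
def IsOpenOpenIrredundant (G : SimpleGraph V) (S : Finset V) : Prop :=
  ∀ v ∈ S, (G.neighborSet v \ ⋃ u ∈ (S : Set V) \ {v}, G.neighborSet u).Nonempty

/-- The open-open irredundance number: the maximum cardinality of an open-open irredundant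
set. -/
noncomputable def openOpenIrredundanceNumber (G : SimpleGraph V) : ℕ :=
  sSup {n | ∃ S : Finset V, IsOpenOpenIrredundant G S ∧ S.card = n}

/-- `DominatorForces G n D`: in the indicated total domination game on `G`, from the position in
which `D` is the set of vertices selected so far and Dominator is to move, Dominator has a strategy
that guarantees, against every play of Staller, that the game ends with a set of at most `n`
vertices.

* The game is over exactly when the selected set is a TD-set.
* Otherwise Dominator indicates a vertex `v` that is not totally dominated yet, and Staller
  adds to `D` any neighbor `u` of `v` that has not been played yet.

The game is only considered on graphs without isolated vertices. -/
inductive DominatorForces [DecidableEq V] (G : SimpleGraph V) (n : ℕ) : Finset V → Prop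
  | finished (D : Finset V) (hD : IsTotalDominatingSet G D) (hn : D.card ≤ n) :
      DominatorForces G n D
  | indicate (D : Finset V) (v : V) (hv : ¬ TotallyDominated G D v)
      (h : ∀ u, G.Adj v u → u ∉ D → DominatorForces G n (insert u D)) :
      DominatorForces G n D

/-- The indicated total domination number: the size of the final set under optimal play, that is,
the least `n` such that Dominator can force the game, started with no vertex selected, to end with
at most `n` selected vertices. -/
noncomputable def indicatedTotalDominationNumber [DecidableEq V] (G : SimpleGraph V) : ℕ :=
  sInf {n | DominatorForces G n ∅}

end Invariants

/-- The graph `H = P₄ ⊕ P₄` (join). The vertices `u₁, v₁, w₁, x₁` of the first path are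
`Sum.inl 0, …, Sum.inl 3`, and `u₂, v₂, w₂, x₂` of the second path are `Sum.inr 0, …, Sum.inr 3`. -/
def graphH : SimpleGraph (Fin 4 ⊕ Fin 4) :=
  graphJoin (SimpleGraph.pathGraph 4) (SimpleGraph.pathGraph 4)

/-- The disjoint union of `k` copies of `H`. -/
def copiesOfH (k : ℕ) : SimpleGraph (Fin k × (Fin 4 ⊕ Fin 4)) where
  Adj a b := a.1 = b.1 ∧ graphH.Adj a.2 b.2
  symm := ⟨fun _ _ h => ⟨h.1.symm, h.2.symm⟩⟩
  loopless := ⟨fun a h => graphH.loopless.irrefl a.2 h.2⟩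

/-- The linking edges `w_{i,2} w_{i+1,1}`, with `i + 1` taken modulo `k`; they are present only for
`k ≥ 2`. -/
def linkingEdges (k : ℕ) : SimpleGraph (Fin k × (Fin 4 ⊕ Fin 4)) :=
  SimpleGraph.fromRel fun a b =>
    2 ≤ k ∧ (a.1.val + 1) % k = b.1.val ∧ a.2 = Sum.inr 2 ∧ b.2 = Sum.inl 2

/-- The graph `G_k`. -/
def graphG (k : ℕ) : SimpleGraph (Fin k × (Fin 4 ⊕ Fin 4)) :=
  copiesOfH k ⊔ linkingEdges k

end IndicatedTotalDomination

/-! Since linking edges join only vertices `w`, every other vertex (an inner one) has all its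
neighbors in its own copy of `H`. If Dominator indicates only inner vertices, Staller has to answer
in the same copy, so Dominator can play the copies one after the other. If Staller always answers in
the copy of the indicated vertex, then at the end the inner vertices of every copy are dominated
from inside it. Hence it suffices to know that a single copy takes three moves, both when Dominator
may indicate only inner vertices and when he has to dominate only inner vertices. Two vertices on
different paths dominate `H`, and so do `v` and `w` of one path. Dominator indicates `u` and `x`,
whose only neighbors on their own path are `v` and `w`. Staller answers the first move by `u` on the
other path and the second by `v` or `w` on the same path as her `u`, after which `x` or `u` is
undominated.

An open-open irredundant set has at most two vertices in a copy. If it meets both paths, a second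
inner vertex on one of them has no private neighbor; on a single path it cannot contain both `u` and
`w`, nor both `x` and `v`, since `N(u) ⊆ N(w)` and `N(x) ⊆ N(v)`. -/

namespace IndicatedTotalDomination

section TotalDomination

variable {V : Type*} {G : SimpleGraph V} {A : Set V} {S : Finset V}

theorem notMem_of_not_totallyDominated {u v : V} (hv : ¬ TotallyDominated G S v)
    (h : G.Adj v u) : u ∉ S :=
  fun hu => hv ⟨u, hu, h.symm⟩

/-- Open-open irredundance required only at the vertices of `A`: each of them that lies in `S` has a
neighbor which no other vertex of `S` dominates. -/
def IsOpenOpenIrredundantOn (G : SimpleGraph V) (A : Set V) (S : Finset V) : Prop :=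
  ∀ v ∈ S, v ∈ A → ∃ p, G.Adj v p ∧ ∀ u ∈ S, u ≠ v → ¬ G.Adj u p

theorem isOpenOpenIrredundantOn_univ :
    IsOpenOpenIrredundantOn G Set.univ S ↔ IsOpenOpenIrredundant G S := by
  simp only [IsOpenOpenIrredundantOn, IsOpenOpenIrredundant, Set.Nonempty, Set.mem_univ,
    true_imp_iff, Set.mem_sdiff, SimpleGraph.mem_neighborSet, Set.mem_iUnion, Finset.mem_coe,
    Set.mem_singleton_iff, not_exists, and_imp]

theorem IsTotalDominatingSet.mono {T : Finset V} (hS : IsTotalDominatingSet G S) (hST : S ⊆ T) :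
    IsTotalDominatingSet G T := fun v =>
  let ⟨u, hu, huv⟩ := hS v
  ⟨u, hST hu, huv⟩

theorem IsOpenOpenIrredundantOn.not_isTotalDominatingSet_erase [DecidableEq V]
    (hS : IsOpenOpenIrredundantOn G A S) {v : V} (hv : v ∈ S) (hvA : v ∈ A) :
    ¬ IsTotalDominatingSet G (S.erase v) := by
  intro hdom
  obtain ⟨p, -, hprivate⟩ := hS v hv hvA
  obtain ⟨u, hu, hup⟩ := hdom p
  exact hprivate u (Finset.mem_of_mem_erase hu) (Finset.ne_of_mem_erase hu) hup

theorem minimal_isTotalDominatingSet_iff :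
    Minimal (IsTotalDominatingSet G) S ↔
      IsTotalDominatingSet G S ∧ IsOpenOpenIrredundant G S := by
  classical
  rw [← isOpenOpenIrredundantOn_univ]
  constructor
  · refine fun hS => ⟨hS.prop, fun v hv _ => ?_⟩
    by_contra! h_not_private
    have h_erase : IsTotalDominatingSet G (S.erase v) := by
      intro p
      obtain ⟨u, hu, hup⟩ := hS.prop p
      rcases eq_or_ne u v with rfl | huv
      · obtain ⟨w, hw, hwu, hwp⟩ := h_not_private p hup
        exact ⟨w, Finset.mem_erase.2 ⟨hwu, hw⟩, hwp⟩
      · exact ⟨u, Finset.mem_erase.2 ⟨huv, hu⟩, hup⟩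
    exact Finset.notMem_erase v S (hS.le_of_le h_erase (Finset.erase_subset v S) hv)
  · rintro ⟨hdom, hirr⟩
    refine ⟨hdom, fun T hT hTS v hv => ?_⟩
    by_contra hvT
    exact hirr.not_isTotalDominatingSet_erase hv trivial
      (hT.mono (Finset.subset_erase.2 ⟨hTS, hvT⟩))

theorem openOpenIrredundanceNumber_eq_card (hS : IsOpenOpenIrredundant G S)
    (hmax : ∀ T, IsOpenOpenIrredundant G T → T.card ≤ S.card) :
    openOpenIrredundanceNumber G = S.card :=
  IsGreatest.csSup_eq ⟨⟨S, hS, rfl⟩, by rintro _ ⟨T, hT, rfl⟩; exact hmax T hT⟩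

theorem upperTotalDominationNumber_eq_card (hdom : IsTotalDominatingSet G S)
    (hS : IsOpenOpenIrredundant G S)
    (hmax : ∀ T, IsOpenOpenIrredundant G T → T.card ≤ S.card) :
    upperTotalDominationNumber G = S.card :=
  IsGreatest.csSup_eq ⟨⟨S, minimal_isTotalDominatingSet_iff.2 ⟨hdom, hS⟩, rfl⟩, by
    rintro _ ⟨T, hT, rfl⟩; exact hmax T (minimal_isTotalDominatingSet_iff.1 hT).2⟩

end TotalDomination

section Game

variable {V : Type*} [DecidableEq V] {G : SimpleGraph V} {A B : Set V} {n : ℕ} {S : Finset V}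

/-- The indicated total domination game in which Dominator may indicate only vertices of `A` and
the game ends as soon as the vertices of `B` are dominated: from the position `S`, Dominator can
make it end with at most `n` selected vertices. This describes the part of a game on a larger graph
that is played in one of its pieces. -/
inductive DominatorForcesOn (G : SimpleGraph V) (A B : Set V) (n : ℕ) : Finset V → Prop
  | finished (S : Finset V) (hS : ∀ v ∈ B, TotallyDominated G S v) (hn : S.card ≤ n) :
      DominatorForcesOn G A B n S
  | indicate (S : Finset V) (v : V) (hvA : v ∈ A) (hv : ¬ TotallyDominated G S v)
      (h : ∀ u, G.Adj v u → u ∉ S → DominatorForcesOn G A B n (insert u S)) :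
      DominatorForcesOn G A B n S

theorem DominatorForcesOn.card_le (hA : ∀ v ∈ A, ∃ u, G.Adj v u)
    (h : DominatorForcesOn G A B n S) : S.card ≤ n := by
  induction h with
  | finished _ _ hn => exact hn
  | indicate S v hvA hv _ ih =>
    obtain ⟨u, hvu⟩ := hA v hvA
    have huS := notMem_of_not_totallyDominated hv hvu
    exact (Finset.card_le_card (Finset.subset_insert u S)).trans (ih u hvu huS)

theorem not_dominatorForcesOn_of_le_card (hA : ∀ v ∈ A, ∃ u, G.Adj v u) (hn : n ≤ S.card)
    {b : V} (hbB : b ∈ B) (hb : ¬ TotallyDominated G S b) : ¬ DominatorForcesOn G A B n S := by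
  rintro (⟨_, hS, _⟩ | ⟨_, v, hvA, hv, h⟩)
  · exact hb (hS b hbB)
  · obtain ⟨u, hvu⟩ := hA v hvA
    have huS := notMem_of_not_totallyDominated hv hvu
    have hcard := (h u hvu huS).card_le hA
    rw [Finset.card_insert_of_notMem huS] at hcard
    omega

end Game

section Slice

variable {ι W : Type*}

/-- The part of `D` in the `i`-th copy of `W`. -/
noncomputable def slice (D : Finset (ι × W)) (i : ι) : Finset W :=
  D.preimage (Prod.mk i) (Prod.mk_right_injective i).injOn

@[simp]
theorem mem_slice {D : Finset (ι × W)} {i : ι} {a : W} : a ∈ slice D i ↔ (i, a) ∈ D :=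
  Finset.mem_preimage

@[simp]
theorem slice_empty (i : ι) : slice (∅ : Finset (ι × W)) i = ∅ :=
  Finset.preimage_empty

theorem slice_insert_self [DecidableEq ι] [DecidableEq W] (D : Finset (ι × W)) (i : ι) (a : W) :
    slice (insert (i, a) D) i = insert a (slice D i) := by
  ext; simp

theorem slice_insert_of_ne [DecidableEq ι] [DecidableEq W] (D : Finset (ι × W)) {i j : ι} (a : W)
    (h : j ≠ i) : slice (insert (i, a) D) j = slice D j := by
  ext; simp [h]

theorem sum_card_slice [Fintype ι] (D : Finset (ι × W)) : ∑ i, (slice D i).card = D.card := by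
  classical
  rw [Finset.card_eq_sum_card_fiberwise (f := Prod.fst) (t := Finset.univ) (by simp)]
  refine Finset.sum_congr rfl fun i _ => ?_
  rw [slice, Finset.card_preimage]
  congr 1
  ext ⟨j, a⟩
  simp [eq_comm]

theorem card_le_mul_card [Fintype ι] {D : Finset (ι × W)} {n : ℕ}
    (h : ∀ i, (slice D i).card ≤ n) : D.card ≤ n * Fintype.card ι := by
  rw [← sum_card_slice, mul_comm]
  exact Finset.sum_le_card_nsmul _ _ _ fun i _ => h i

theorem mul_card_le_card [Fintype ι] {D : Finset (ι × W)} {n : ℕ}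
    (h : ∀ i, n ≤ (slice D i).card) : n * Fintype.card ι ≤ D.card := by
  rw [← sum_card_slice, mul_comm]
  exact Finset.card_nsmul_le_sum _ _ _ fun i _ => h i

end Slice

/-- `G` consists of copies of `K` indexed by `ι` and of further edges which avoid the copies of the
vertices in `A`, the inner vertices. -/
structure IsLinkedUnion {ι W : Type*} (K : SimpleGraph W) (A : Set W) (G : SimpleGraph (ι × W)) :
    Prop where
  adj_mk (i : ι) {a b : W} : K.Adj a b → G.Adj (i, a) (i, b)
  adj_of_mem {i j : ι} {a b : W} : a ∈ A → G.Adj (i, a) (j, b) → i = j ∧ K.Adj a b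

namespace IsLinkedUnion

variable {ι W : Type*} {K : SimpleGraph W} {A : Set W} {G : SimpleGraph (ι × W)} {n : ℕ}
  {D : Finset (ι × W)}

section Domination

theorem totallyDominated_mk (hG : IsLinkedUnion K A G) {i : ι} {a : W}
    (h : TotallyDominated K (slice D i) a) : TotallyDominated G D (i, a) := by
  obtain ⟨u, hu, hua⟩ := h
  exact ⟨(i, u), mem_slice.1 hu, hG.adj_mk i hua⟩

theorem totallyDominated_slice (hG : IsLinkedUnion K A G) {i : ι} {a : W} (ha : a ∈ A)
    (h : TotallyDominated G D (i, a)) : TotallyDominated K (slice D i) a := by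
  obtain ⟨⟨j, u⟩, hu, hua⟩ := h
  obtain ⟨rfl, hau⟩ := hG.adj_of_mem ha hua.symm
  exact ⟨u, mem_slice.2 hu, hau.symm⟩

theorem isTotalDominatingSet_univ_product [Fintype ι] (hG : IsLinkedUnion K A G) {T : Finset W}
    (hT : IsTotalDominatingSet K T) : IsTotalDominatingSet G (Finset.univ ×ˢ T) := by
  rintro ⟨i, a⟩
  obtain ⟨u, hu, hua⟩ := hT a
  exact ⟨(i, u), Finset.mk_mem_product (Finset.mem_univ i) hu, hG.adj_mk i hua⟩

theorem isOpenOpenIrredundant_univ_product [Fintype ι] (hG : IsLinkedUnion K A G) {T : Finset W}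
    (hT : ∀ v ∈ T, ∃ p ∈ A, K.Adj v p ∧ ∀ u ∈ T, u ≠ v → ¬ K.Adj u p) :
    IsOpenOpenIrredundant G (Finset.univ ×ˢ T) := by
  rw [← isOpenOpenIrredundantOn_univ]
  rintro ⟨i, v⟩ hv -
  obtain ⟨p, hpA, hvp, hprivate⟩ := hT v (Finset.mem_product.1 hv).2
  refine ⟨(i, p), hG.adj_mk i hvp, ?_⟩
  rintro ⟨j, u⟩ hu hne hup
  obtain ⟨rfl, hpu⟩ := hG.adj_of_mem hpA hup.symm
  exact hprivate u (Finset.mem_product.1 hu).2 (fun huv => hne (by rw [huv])) hpu.symm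

theorem isOpenOpenIrredundantOn_slice (hG : IsLinkedUnion K A G)
    (hD : IsOpenOpenIrredundant G D) (i : ι) : IsOpenOpenIrredundantOn K A (slice D i) := by
  rw [← isOpenOpenIrredundantOn_univ] at hD
  intro a ha haA
  obtain ⟨⟨j, p⟩, hap, hprivate⟩ := hD (i, a) (mem_slice.1 ha) trivial
  obtain ⟨rfl, hap'⟩ := hG.adj_of_mem haA hap
  exact ⟨p, hap', fun u hu hua hup =>
    hprivate (i, u) (mem_slice.1 hu) (by simpa using hua) (hG.adj_mk i hup)⟩

end Domination

section Game

variable [DecidableEq ι] [DecidableEq W] [Fintype ι]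

theorem dominatorForces (hG : IsLinkedUnion K A G)
    (hD : ∀ i, DominatorForcesOn K A Set.univ n (slice D i)) :
    DominatorForces G (n * Fintype.card ι) D := by
  suffices h : ∀ (T : Finset ι) (D : Finset (ι × W)),
      (∀ i ∈ T, DominatorForcesOn K A Set.univ n (slice D i)) →
      (∀ i ∉ T, IsTotalDominatingSet K (slice D i) ∧ (slice D i).card ≤ n) →
      DominatorForces G (n * Fintype.card ι) D from
    h Finset.univ D (fun i _ => hD i) (by simp)
  intro T
  induction T using Finset.induction_on with
  | empty =>
    intro D _ hdone
    exact .finished D (fun ⟨i, a⟩ => hG.totallyDominated_mk ((hdone i (by simp)).1 a))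
      (card_le_mul_card fun i => (hdone i (by simp)).2)
  | insert i T hiT ih =>
    intro D hopen hdone
    -- The inner induction follows the play in the `i`-th copy while all other slices stay the same.
    generalize hS : slice D i = S
    have hforces : DominatorForcesOn K A Set.univ n S := hS ▸ hopen i (Finset.mem_insert_self i T)
    induction hforces generalizing D with
    | finished S hdom hn =>
      refine ih D (fun j hj => hopen j (Finset.mem_insert_of_mem hj)) fun j hj => ?_
      rcases eq_or_ne j i with rfl | hji
      · exact hS ▸ ⟨fun v => hdom v trivial, hn⟩
      · exact hdone j (by simp [hji, hj])
    | indicate S v hvA hv hreply ih_reply =>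
      refine .indicate D (i, v) (fun h => hv (hS ▸ hG.totallyDominated_slice hvA h)) ?_
      rintro ⟨j, u⟩ hvu hu
      obtain ⟨rfl, hvu'⟩ := hG.adj_of_mem hvA hvu
      have huS : u ∉ S := hS ▸ mt mem_slice.1 hu
      have hslice : slice (insert (i, u) D) i = insert u S := by rw [slice_insert_self, hS]
      refine ih_reply u hvu' huS _ (fun j hj => ?_) (fun j hj => ?_) hslice
      · rcases eq_or_ne j i with rfl | hji
        · exact hslice ▸ hreply u hvu' huS
        · exact slice_insert_of_ne D u hji ▸ hopen j hj
      · have hji : j ≠ i := fun h => hj (h ▸ Finset.mem_insert_self i T)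
        exact slice_insert_of_ne D u hji ▸ hdone j hj

theorem mul_card_le_of_dominatorForces (hG : IsLinkedUnion K A G) {N : ℕ}
    (h : DominatorForces G N D) (hD : ∀ i, ¬ DominatorForcesOn K Set.univ A n (slice D i)) :
    (n + 1) * Fintype.card ι ≤ N := by
  induction h with
  | finished D hdom hN =>
    refine (mul_card_le_card fun i => ?_).trans hN
    by_contra! hcard
    exact hD i (.finished _ (fun a ha => hG.totallyDominated_slice ha (hdom (i, a))) (by omega))
  | indicate D v hv _ ih =>
    obtain ⟨i, v⟩ := v
    have hv_slice : ¬ TotallyDominated K (slice D i) v := mt hG.totallyDominated_mk hv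
    obtain ⟨u, hvu, huD, hu⟩ : ∃ u, K.Adj v u ∧ u ∉ slice D i ∧
        ¬ DominatorForcesOn K Set.univ A n (insert u (slice D i)) := by
      by_contra! hall
      exact hD i (.indicate _ v trivial hv_slice hall)
    refine ih (i, u) (hG.adj_mk i hvu) (mt mem_slice.2 huD) fun j => ?_
    rcases eq_or_ne j i with rfl | hji
    · rwa [slice_insert_self]
    · rw [slice_insert_of_ne D u hji]
      exact hD j

theorem indicatedTotalDominationNumber_eq (hG : IsLinkedUnion K A G)
    (hle : DominatorForcesOn K A Set.univ (n + 1) ∅)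
    (hlt : ¬ DominatorForcesOn K Set.univ A n ∅) :
    indicatedTotalDominationNumber G = (n + 1) * Fintype.card ι :=
  IsLeast.csInf_eq ⟨hG.dominatorForces fun i => by rwa [slice_empty], fun _ h =>
    hG.mul_card_le_of_dominatorForces h fun i => by rwa [slice_empty]⟩

end Game

theorem preconnected (hG : IsLinkedUnion K A G) (hK : K.Preconnected) {Q : SimpleGraph ι}
    (hQ : Q.Preconnected) (hlink : ∀ i j, Q.Adj i j → ∃ a b, G.Adj (i, a) (j, b)) :
    G.Preconnected := by
  have reachable_copy (i : ι) (a b : W) : G.Reachable (i, a) (i, b) :=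
    (hK a b).map (⟨Prod.mk i, hG.adj_mk i⟩ : K →g G)
  rintro ⟨i, a⟩ ⟨j, b⟩
  have hij := (Q.reachable_iff_reflTransGen i j).1 (hQ i j)
  induction hij generalizing b with
  | refl => exact reachable_copy i a b
  | tail _ hadj ih =>
    obtain ⟨c, d, hcd⟩ := hlink _ _ hadj
    exact ((ih c).trans hcd.reachable).trans (reachable_copy _ d b)

end IsLinkedUnion

section Join

variable {V : Type*} {G : SimpleGraph V}

/-- The vertex `a` of one of the two copies of `G` in `graphJoin G G`, the copy being named by a
Boolean so that the two copies can be treated alike. -/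
def side : Bool → V → V ⊕ V
  | false => Sum.inl
  | true => Sum.inr

theorem exists_eq_side (x : V ⊕ V) : ∃ s a, x = side s a := by
  rcases x with a | a
  exacts [⟨false, a, rfl⟩, ⟨true, a, rfl⟩]

theorem side_eq_side_iff {s t : Bool} {a b : V} : side s a = side t b ↔ s = t ∧ a = b := by
  cases s <;> cases t <;> simp [side]

theorem graphJoin_adj_side {s t : Bool} {a b : V} :
    (graphJoin G G).Adj (side s a) (side t b) ↔ s ≠ t ∨ G.Adj a b := by
  cases s <;> cases t <;> simp [side, graphJoin]

theorem graphJoin_self_preconnected : (graphJoin G G).Preconnected := by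
  intro x y
  obtain ⟨s, a, rfl⟩ := exists_eq_side x
  obtain ⟨t, b, rfl⟩ := exists_eq_side y
  have adj_of_ne {s t : Bool} (a b : V) (h : s ≠ t) :
      (graphJoin G G).Adj (side s a) (side t b) := graphJoin_adj_side.2 (.inl h)
  rcases eq_or_ne s t with rfl | hst
  · exact (adj_of_ne a a (Bool.not_ne_self s).symm).reachable.trans
      (adj_of_ne a b (Bool.not_ne_self s)).reachable
  · exact (adj_of_ne a b hst).reachable

theorem isTotalDominatingSet_graphJoin_of_mem_sides {S : Finset (V ⊕ V)} {s t : Bool} {a b : V}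
    (hst : s ≠ t) (ha : side s a ∈ S) (hb : side t b ∈ S) :
    IsTotalDominatingSet (graphJoin G G) S := by
  intro x
  obtain ⟨r, c, rfl⟩ := exists_eq_side x
  rcases eq_or_ne s r with rfl | hsr
  · exact ⟨side t b, hb, graphJoin_adj_side.2 (.inl hst.symm)⟩
  · exact ⟨side s a, ha, graphJoin_adj_side.2 (.inl hsr)⟩

theorem isTotalDominatingSet_graphJoin_of_side {S : Finset (V ⊕ V)} {T : Finset V}
    (s : Bool) (hT : IsTotalDominatingSet G T) (hTS : ∀ a ∈ T, side s a ∈ S) :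
    IsTotalDominatingSet (graphJoin G G) S := by
  intro x
  obtain ⟨r, c, rfl⟩ := exists_eq_side x
  obtain ⟨u, hu, huc⟩ := hT c
  exact ⟨side s u, hTS u hu, graphJoin_adj_side.2 (.inr huc)⟩

end Join

section PathJoin

variable {S : Finset (Fin 4 ⊕ Fin 4)} {s : Bool}

/-- The vertices of `H` other than `w₁` and `w₂`, which are the ends of linking edges. -/
def innerVertices : Set (Fin 4 ⊕ Fin 4) := {Sum.inl 2, Sum.inr 2}ᶜ

theorem side_mem_innerVertices {a : Fin 4} : side s a ∈ innerVertices ↔ a ≠ 2 := by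
  cases s <;> simp [innerVertices, side]

theorem graphH_adj_side {s t : Bool} {a b : Fin 4} :
    graphH.Adj (side s a) (side t b) ↔ s ≠ t ∨ (SimpleGraph.pathGraph 4).Adj a b :=
  graphJoin_adj_side

theorem graphH_preconnected : graphH.Preconnected := graphJoin_self_preconnected

theorem exists_graphH_adj (x : Fin 4 ⊕ Fin 4) : ∃ y, graphH.Adj x y := by
  obtain ⟨s, a, rfl⟩ := exists_eq_side x
  exact ⟨side (!s) 0, graphH_adj_side.2 (.inl (Bool.not_ne_self s).symm)⟩

theorem pathGraph_four_adj_zero {a : Fin 4} : (SimpleGraph.pathGraph 4).Adj a 0 ↔ a = 1 := by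
  rw [SimpleGraph.pathGraph_adj]; revert a; decide

theorem pathGraph_four_adj_one {a : Fin 4} :
    (SimpleGraph.pathGraph 4).Adj a 1 ↔ a = 0 ∨ a = 2 := by
  rw [SimpleGraph.pathGraph_adj]; revert a; decide

theorem pathGraph_four_adj_two {a : Fin 4} :
    (SimpleGraph.pathGraph 4).Adj a 2 ↔ a = 1 ∨ a = 3 := by
  rw [SimpleGraph.pathGraph_adj]; revert a; decide

theorem pathGraph_four_adj_three {a : Fin 4} : (SimpleGraph.pathGraph 4).Adj a 3 ↔ a = 2 := by
  rw [SimpleGraph.pathGraph_adj]; revert a; decide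

theorem isTotalDominatingSet_pathGraph_four :
    IsTotalDominatingSet (SimpleGraph.pathGraph 4) {1, 2} := by
  intro a
  fin_cases a <;> simp [TotallyDominated, pathGraph_four_adj_zero, pathGraph_four_adj_one,
    pathGraph_four_adj_two, pathGraph_four_adj_three]

section Dominator

theorem isTotalDominatingSet_graphH_of_mem_of_totallyDominated (h1 : side s 1 ∈ S)
    (h3 : TotallyDominated graphH S (side s 3)) : IsTotalDominatingSet graphH S := by
  obtain ⟨x, hx, hadj⟩ := h3
  obtain ⟨t, b, rfl⟩ := exists_eq_side x
  rcases eq_or_ne t s with rfl | hts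
  · obtain rfl : b = 2 := by simpa [graphH_adj_side, pathGraph_four_adj_three] using hadj
    exact isTotalDominatingSet_graphJoin_of_side t isTotalDominatingSet_pathGraph_four
      (by simp [h1, hx])
  · exact isTotalDominatingSet_graphJoin_of_mem_sides hts hx h1

theorem dominatorForcesOn_graphH_of_mem {n : ℕ} (h1 : side s 1 ∈ S) (hS : S.card ≤ n) :
    DominatorForcesOn graphH innerVertices Set.univ (n + 1) S := by
  by_cases h3 : TotallyDominated graphH S (side s 3)
  · have hdom := isTotalDominatingSet_graphH_of_mem_of_totallyDominated h1 h3
    exact .finished S (fun v _ => hdom v) (by omega)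
  · refine .indicate S (side s 3) (side_mem_innerVertices.2 (by decide)) h3 fun u hu _ => ?_
    have hdom := isTotalDominatingSet_graphH_of_mem_of_totallyDominated
      (Finset.mem_insert_of_mem h1) ⟨u, Finset.mem_insert_self u S, hu.symm⟩
    exact .finished _ (fun v _ => hdom v) ((Finset.card_insert_le u S).trans (by omega))

theorem dominatorForcesOn_graphH_singleton (s : Bool) (a : Fin 4) :
    DominatorForcesOn graphH innerVertices Set.univ 3 {side s a} := by
  rcases eq_or_ne a 1 with rfl | ha
  · exact dominatorForcesOn_graphH_of_mem (Finset.mem_singleton_self _) (by simp)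
  refine .indicate _ (side s 0) (side_mem_innerVertices.2 (by decide))
    (by simpa [TotallyDominated, graphH_adj_side, pathGraph_four_adj_zero] using ha)
    fun u hu _ => ?_
  obtain ⟨t, b, rfl⟩ := exists_eq_side u
  rcases eq_or_ne t s with rfl | hts
  · obtain rfl : b = 1 := by
      simpa [graphH_adj_side, pathGraph_four_adj_zero] using hu.symm
    exact dominatorForcesOn_graphH_of_mem (Finset.mem_insert_self _ _) Finset.card_le_two
  · have hdom : IsTotalDominatingSet graphH {side t b, side s a} :=
      isTotalDominatingSet_graphJoin_of_mem_sides hts (Finset.mem_insert_self _ _)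
        (Finset.mem_insert_of_mem (Finset.mem_singleton_self _))
    exact .finished _ (fun v _ => hdom v) (Finset.card_le_two.trans (by decide))

theorem dominatorForcesOn_graphH_three :
    DominatorForcesOn graphH innerVertices Set.univ 3 ∅ := by
  refine .indicate ∅ (side false 0) (side_mem_innerVertices.2 (by decide))
    (by simp [TotallyDominated]) fun u _ _ => ?_
  obtain ⟨s, a, rfl⟩ := exists_eq_side u
  exact dominatorForcesOn_graphH_singleton s a

end Dominator

section Staller

theorem not_dominatorForcesOn_graphH_pair {a b : Fin 4} (ha : a ≠ 0) (hb : b ≠ 2)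
    (hab : ¬ (SimpleGraph.pathGraph 4).Adj a b) (h0b : ¬ (SimpleGraph.pathGraph 4).Adj 0 b)
    (s : Bool) :
    ¬ DominatorForcesOn graphH Set.univ innerVertices 2 {side s a, side s 0} := by
  have hne : side s a ≠ side s 0 := by simp [side_eq_side_iff, ha]
  refine not_dominatorForcesOn_of_le_card (fun v _ => exists_graphH_adj v)
    (Finset.card_pair hne).ge (b := side s b) (side_mem_innerVertices.2 hb) ?_
  simp [TotallyDominated, graphH_adj_side, hab, h0b]

theorem not_dominatorForcesOn_graphH_singleton (s : Bool) :
    ¬ DominatorForcesOn graphH Set.univ innerVertices 2 {side s 0} := by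
  rintro (⟨_, hdom, _⟩ | ⟨_, v, _, hv, hreply⟩)
  · simpa [TotallyDominated] using hdom (side s 0) (side_mem_innerVertices.2 (by decide))
  obtain ⟨t, a, rfl⟩ := exists_eq_side v
  obtain ⟨rfl, ha⟩ : s = t ∧ a ≠ 1 := by
    simpa [TotallyDominated, graphH_adj_side, SimpleGraph.adj_comm _ 0 a,
      pathGraph_four_adj_zero] using hv
  obtain ha3 | ha02 : a = 3 ∨ a = 0 ∨ a = 2 := by omega
  · have hadj : (SimpleGraph.pathGraph 4).Adj 2 a := ha3 ▸ pathGraph_four_adj_three.2 rfl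
    refine not_dominatorForcesOn_graphH_pair (a := 2) (b := 0) (by decide) (by decide)
      (by simp [pathGraph_four_adj_zero]) (by simp) s ?_
    exact hreply (side s 2) (graphH_adj_side.2 (.inr hadj.symm)) (by simp [side_eq_side_iff])
  · have hadj : (SimpleGraph.pathGraph 4).Adj a 1 := pathGraph_four_adj_one.2 ha02
    refine not_dominatorForcesOn_graphH_pair (a := 1) (b := 3) (by decide) (by decide)
      (by simp [pathGraph_four_adj_three]) (by simp [pathGraph_four_adj_three]) s ?_
    exact hreply (side s 1) (graphH_adj_side.2 (.inr hadj)) (by simp [side_eq_side_iff])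

theorem not_dominatorForcesOn_graphH_two :
    ¬ DominatorForcesOn graphH Set.univ innerVertices 2 ∅ := by
  rintro (⟨_, hdom, _⟩ | ⟨_, v, _, _, hreply⟩)
  · simpa [TotallyDominated] using
      hdom (side false 0) (side_mem_innerVertices.2 (by decide))
  · obtain ⟨s, a, rfl⟩ := exists_eq_side v
    refine not_dominatorForcesOn_graphH_singleton (!s) (hreply (side (!s) 0) ?_ (by simp))
    exact graphH_adj_side.2 (.inl (Bool.not_ne_self s).symm)

end Staller

section Irredundance

theorem eq_of_isOpenOpenIrredundantOn_graphH
    (hS : IsOpenOpenIrredundantOn graphH innerVertices S) {t : Bool} (hst : s ≠ t) {a b c : Fin 4}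
    (ha : side s a ∈ S) (hb : side s b ∈ S) (hc : side t c ∈ S) : a = b := by
  by_contra! hab
  wlog ha2 : a ≠ 2 generalizing a b
  · exact this hb ha hab.symm fun hb2 => hab ((not_ne_iff.1 ha2).trans hb2.symm)
  have hb' : side s b ∈ S.erase (side s a) :=
    Finset.mem_erase.2 ⟨by simp [side_eq_side_iff, hab.symm], hb⟩
  have hc' : side t c ∈ S.erase (side s a) :=
    Finset.mem_erase.2 ⟨by simp [side_eq_side_iff, hst.symm], hc⟩
  exact hS.not_isTotalDominatingSet_erase ha (side_mem_innerVertices.2 ha2)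
    (isTotalDominatingSet_graphJoin_of_mem_sides hst hb' hc')

theorem side_notMem_of_isOpenOpenIrredundantOn_graphH
    (hS : IsOpenOpenIrredundantOn graphH innerVertices S) {a b : Fin 4} (ha2 : a ≠ 2) (hab : a ≠ b)
    (hN : ∀ p, (SimpleGraph.pathGraph 4).Adj p a → (SimpleGraph.pathGraph 4).Adj p b)
    (ha : side s a ∈ S) : side s b ∉ S := by
  intro hb
  obtain ⟨p, hap, hprivate⟩ := hS _ ha (side_mem_innerVertices.2 ha2)
  obtain ⟨r, d, rfl⟩ := exists_eq_side p
  refine hprivate _ hb (by simp [side_eq_side_iff, hab.symm]) ?_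
  exact graphH_adj_side.2 ((graphH_adj_side.1 hap).imp_right fun h => (hN d h.symm).symm)

theorem card_le_two_of_subset_side (hS : IsOpenOpenIrredundantOn graphH innerVertices S)
    (hs : ∀ x ∈ S, ∃ a, x = side s a) : S.card ≤ 2 := by
  have h02 : side s 0 ∈ S → side s 2 ∉ S :=
    side_notMem_of_isOpenOpenIrredundantOn_graphH hS (by decide) (by decide)
      (by simp +contextual [pathGraph_four_adj_zero, pathGraph_four_adj_two])
  have h31 : side s 3 ∈ S → side s 1 ∉ S :=
    side_notMem_of_isOpenOpenIrredundantOn_graphH hS (by decide) (by decide)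
      (by simp +contextual [pathGraph_four_adj_one, pathGraph_four_adj_three])
  have hsub : S ⊆ {side s (if side s 0 ∈ S then 0 else 2),
      side s (if side s 3 ∈ S then 3 else 1)} := by
    intro x hx
    obtain ⟨a, rfl⟩ := hs x hx
    fin_cases a <;> grind
  exact (Finset.card_le_card hsub).trans Finset.card_le_two

theorem card_le_two_of_isOpenOpenIrredundantOn_graphH
    (hS : IsOpenOpenIrredundantOn graphH innerVertices S) : S.card ≤ 2 := by
  rcases S.eq_empty_or_nonempty with rfl | ⟨x, hx⟩
  · simp
  obtain ⟨s, a, rfl⟩ := exists_eq_side x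
  by_cases hboth : ∃ b, side (!s) b ∈ S
  · obtain ⟨b, hb⟩ := hboth
    have hsub : S ⊆ {side s a, side (!s) b} := by
      intro y hy
      obtain ⟨r, c, rfl⟩ := exists_eq_side y
      obtain rfl | rfl : r = s ∨ r = !s := Bool.eq_or_eq_not r s
      · simp [eq_of_isOpenOpenIrredundantOn_graphH hS (Bool.not_ne_self r).symm hy hx hb]
      · simp [eq_of_isOpenOpenIrredundantOn_graphH hS (Bool.not_ne_self s) hy hb hx]
    exact (Finset.card_le_card hsub).trans Finset.card_le_two
  · refine card_le_two_of_subset_side (s := s) hS fun y hy => ?_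
    obtain ⟨r, c, rfl⟩ := exists_eq_side y
    obtain rfl | rfl : r = s ∨ r = !s := Bool.eq_or_eq_not r s
    · exact ⟨c, rfl⟩
    · exact absurd ⟨c, hy⟩ hboth

theorem isTotalDominatingSet_graphH_middle : IsTotalDominatingSet graphH {side s 1, side s 2} :=
  isTotalDominatingSet_graphJoin_of_side s isTotalDominatingSet_pathGraph_four (by simp)

theorem exists_inner_private_neighbor_middle :
    ∀ v ∈ ({side s 1, side s 2} : Finset (Fin 4 ⊕ Fin 4)), ∃ p ∈ innerVertices,
      graphH.Adj v p ∧ ∀ u ∈ ({side s 1, side s 2} : Finset _), u ≠ v → ¬ graphH.Adj u p := by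
  intro v hv
  rw [Finset.mem_insert, Finset.mem_singleton] at hv
  rcases hv with rfl | rfl
  · exact ⟨side s 0, side_mem_innerVertices.2 (by decide), by
      simp [graphH_adj_side, pathGraph_four_adj_zero]⟩
  · exact ⟨side s 3, side_mem_innerVertices.2 (by decide), by
      simp [graphH_adj_side, pathGraph_four_adj_three]⟩

end Irredundance

end PathJoin

section GraphG

variable {k : ℕ}

theorem isLinkedUnion_graphG (k : ℕ) : IsLinkedUnion graphH innerVertices (graphG k) where
  adj_mk _ _ _ h := Or.inl ⟨rfl, h⟩
  adj_of_mem := by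
    rintro i j a b ha (h | ⟨-, h | h⟩)
    · exact h
    · exact absurd (Or.inr h.2.2.1) ha
    · exact absurd (Or.inl h.2.2.2) ha

theorem graphG_adj_of_succ_eq {i j : Fin k} (h : i.val + 1 = j.val) :
    (graphG k).Adj (i, Sum.inr 2) (j, Sum.inl 2) :=
  Or.inr ⟨by simp, Or.inl ⟨by omega, h ▸ Nat.mod_eq_of_lt (h ▸ j.isLt), rfl, rfl⟩⟩

theorem graphG_connected (hk : 1 ≤ k) : (graphG k).Connected := by
  have : Nonempty (Fin k) := ⟨⟨0, hk⟩⟩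
  refine ⟨(isLinkedUnion_graphG k).preconnected graphH_preconnected
    (SimpleGraph.pathGraph_preconnected k) fun i j hij => ?_⟩
  rcases SimpleGraph.pathGraph_adj.1 hij with h | h
  · exact ⟨_, _, graphG_adj_of_succ_eq h⟩
  · exact ⟨_, _, (graphG_adj_of_succ_eq h).symm⟩

end GraphG

end IndicatedTotalDomination

open IndicatedTotalDomination in
theorem mainTheorem5_general {ι : Type*} [Fintype ι] [DecidableEq ι]
    {G : SimpleGraph (ι × (Fin 4 ⊕ Fin 4))} (hG : IsLinkedUnion graphH innerVertices G) :
    indicatedTotalDominationNumber G = 3 * Fintype.card ι ∧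
      upperTotalDominationNumber G = 2 * Fintype.card ι ∧
      openOpenIrredundanceNumber G = 2 * Fintype.card ι := by
  let S : Finset (ι × (Fin 4 ⊕ Fin 4)) := Finset.univ ×ˢ {side false 1, side false 2}
  have hcard : S.card = 2 * Fintype.card ι := by
    simp [S, Finset.card_product, side_eq_side_iff, mul_comm]
  have hdom : IsTotalDominatingSet G S :=
    hG.isTotalDominatingSet_univ_product isTotalDominatingSet_graphH_middle
  have hirr : IsOpenOpenIrredundant G S :=
    hG.isOpenOpenIrredundant_univ_product exists_inner_private_neighbor_middle
  have hmax : ∀ T, IsOpenOpenIrredundant G T → T.card ≤ S.card := fun T hT =>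
    hcard ▸ card_le_mul_card fun i =>
      card_le_two_of_isOpenOpenIrredundantOn_graphH (hG.isOpenOpenIrredundantOn_slice hT i)
  exact ⟨hG.indicatedTotalDominationNumber_eq dominatorForcesOn_graphH_three
      not_dominatorForcesOn_graphH_two,
    hcard ▸ upperTotalDominationNumber_eq_card hdom hirr hmax,
    hcard ▸ openOpenIrredundanceNumber_eq_card hirr hmax⟩

theorem mainTheorem5 :
    (∀ k : ℕ, 1 ≤ k →
      IndicatedTotalDomination.indicatedTotalDominationNumber
          (IndicatedTotalDomination.graphG k) = 3 * k ∧
      IndicatedTotalDomination.upperTotalDominationNumber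
          (IndicatedTotalDomination.graphG k) = 2 * k ∧
      IndicatedTotalDomination.openOpenIrredundanceNumber
          (IndicatedTotalDomination.graphG k) = 2 * k) ∧
    (∀ m : ℕ, ∃ k : ℕ, 1 ≤ k ∧ (IndicatedTotalDomination.graphG k).Connected ∧
      IndicatedTotalDomination.upperTotalDominationNumber
          (IndicatedTotalDomination.graphG k) + m ≤
        IndicatedTotalDomination.indicatedTotalDominationNumber
          (IndicatedTotalDomination.graphG k) ∧
      IndicatedTotalDomination.openOpenIrredundanceNumber
          (IndicatedTotalDomination.graphG k) + m ≤
        IndicatedTotalDomination.indicatedTotalDominationNumber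
          (IndicatedTotalDomination.graphG k)) := by
  have values (k : ℕ) := Fintype.card_fin k ▸
    mainTheorem5_general (IndicatedTotalDomination.isLinkedUnion_graphG k)
  refine ⟨fun k _ => values k, fun m => ⟨m + 1, by omega,
    IndicatedTotalDomination.graphG_connected (by omega), ?_⟩⟩
  obtain ⟨hgame, hupper, hirr⟩ := values (m + 1)
  omega
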